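/- **Setting.** Let $d,T,m\ge 1$ be integers and $B>0$. For $t=1,\dots,T$, an adversary, who sees the whole history of the first $t-1$ rounds, selects a context $x_t\in[0,1]^d$ and a label $y_t\in[0,1]$; the learner sees $x_t$ (but not $y_t$), selects a probability distribution $w_t$ on $\mathcal P=\{0,\frac1m,\dots,1\}$, and a forecast $p_t\in\mathcal P$ is drawn from $w_t$; then $y_t$ is revealed. For a transcript $\pi_T=\{(x_t,y_t,p_t)\}_{t=1}^T$ and a class $\mathcal H$ of functions $[0,1]^d\to\mathbb R$, the $\ell_1$-multicalibration error is $$K(\pi_T,\mathcal H)=\sup_{h\in\mathcal H}\ \sum_{p\in\mathcal P}\frac1T\Big|\sum_{t\,:\,p_t=p}h(x_t)\,(y_t-p_t)\Big| .$$ Let $\mathcal H=\{x\mapsto\langle h,x\rangle : h\in\mathbb R^d,\ \|h\|_1\le B\}$ be the class of bounded linear functions. **Claim.** There are a single algorithm on a real RAM (unit-cost arithmetic and comparisons of reals; addition, subtraction and comparison of indices; indirect addressing), which gets $d$, $T$ and $B$ as input, and an absolute constant $C>0$ such that for all $d\ge1$, $T\ge1$ and $B>0$ with $BT\ge2$, the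 algorithm, with some discretization $m\ge1$ that it computes, has the following properties. 1. *Runtime.* Its set-up and each of its rounds (including reading the context and drawing the forecast) take at most $C\,(\max\{1,B\}\sqrt T)^d$ steps, that is, $O((B\sqrt T)^d)$ steps for $B\ge1$. If $d\ge3$, then the total over the set-up and all $T$ rounds is also at most $C\,(\max\{1,B\}\sqrt T)^d$. 2. *Error.* Against every adversary, $$\mathbb E\big[K(\pi_T,\mathcal H)\big]\ \le\ C\,B\,d^{1/2}\,T^{-1/3}\log(BT).$$ -/

import Mathlib

noncomputable section

namespace OnlineMC

/-! ### The online protocol and the multicalibration error -/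

/-- The context space `[0,1]^d`. -/
abbrev Context (d : ℕ) : Type := Fin d → unitInterval

/-- One round of interaction: the context `x_t`, the forecast `p_t = pred / m` in
`{0, 1/m, …, 1}`, and the label `y_t ∈ [0,1]`. -/
structure Round (d m : ℕ) where
  context : Context d
  pred : Fin (m + 1)
  label : unitInterval

/-- Transcripts and histories, in chronological order. -/
abbrev History (d m : ℕ) : Type := List (Round d m)

/-- `K(π, h) = ∑_{p} (1/T) |∑_{t : p_t = p} h(x_t) (y_t - p)|`, where `T` is the length of `π` and
`p` ranges over `{0, 1/m, …, 1}`. -/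
def calError {d m : ℕ} (π : History d m) (h : Context d → ℝ) : ℝ :=
  ∑ p : Fin (m + 1), (1 / (π.length : ℝ)) *
    |((π.filter (fun r => r.pred = p)).map
        (fun r => h r.context * ((r.label : ℝ) - (p : ℝ) / (m : ℝ)))).sum|

/-- `K(π, 𝓗)`, the supremum of `K(π, h)` over `h ∈ 𝓗`. -/
def multiCalError {d m : ℕ} (π : History d m) (H : Set (Context d → ℝ)) : ℝ :=
  sSup (calError π '' H)

/-- The linear functions `x ↦ ⟨h, x⟩` on `[0,1]^d` with `‖h‖₁ ≤ B`. -/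
def linearClass (d : ℕ) (B : ℝ) : Set (Context d → ℝ) :=
  {f | ∃ h : Fin d → ℝ, ∑ i, |h i| ≤ B ∧ f = fun x => ∑ i, h i * (x i : ℝ)}

/-- A learner: given the history and the current context it selects a probability distribution
`w_t` on the forecasts `{0, 1/m, …, 1}`. -/
abbrev Learner (d m : ℕ) : Type := History d m → Context d → stdSimplex ℝ (Fin (m + 1))

/-- An adaptive adversary: it selects the next context and label from the whole history, including
the realized forecasts, but before the next forecast is drawn. (A randomized adversary is a
mixture of these, so a bound that holds for all of these holds for it as well.) -/
abbrev Adversary (d m : ℕ) : Type := History d m → Context d × unitInterval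

/-- The expectation of `F` of the transcript when `n` further rounds are played after the history
`π`, each forecast being drawn from the distribution that the learner selects. -/
def expect {d m : ℕ} (L : Learner d m) (adv : Adversary d m) (F : History d m → ℝ) :
    ℕ → History d m → ℝ
  | 0, π => F π
  | n + 1, π => ∑ p : Fin (m + 1),
      (L π (adv π).1 : Fin (m + 1) → ℝ) p *
        expect L adv F n (π ++ [⟨(adv π).1, p, (adv π).2⟩])

/-! ### A real RAM

Index registers hold natural numbers, real registers hold real numbers, and there are arrays of
real numbers that are addressed through the index registers. Index registers can only be set to a
constant, added and subtracted; real registers can be added, subtracted, multiplied, divided.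
Each instruction and each test of a condition is one step. -/

/-- A memory state. A program mentions only finitely many registers and arrays. -/
structure State where
  idx : ℕ → ℕ
  acc : ℕ → ℝ
  arr : ℕ → ℕ → ℝ

inductive ArithOp where
  | add | sub | mul | div

def ArithOp.eval : ArithOp → ℝ → ℝ → ℝ
  | .add, a, b => a + b
  | .sub, a, b => a - b
  | .mul, a, b => a * b
  | .div, a, b => a / b

inductive Instr where
  /-- `idx i := c` -/
  | setIdx (i c : ℕ)
  /-- `idx i := idx j + idx k` -/
  | addIdx (i j k : ℕ)
  /-- `idx i := idx j - idx k` (truncated at zero) -/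
  | subIdx (i j k : ℕ)
  /-- `acc a := idx i` -/
  | cast (a i : ℕ)
  /-- `acc a := acc b ∘ acc c` for an arithmetic operation `∘` -/
  | arith (op : ArithOp) (a b c : ℕ)
  /-- `acc a := arr A [idx i]` -/
  | load (a A i : ℕ)
  /-- `arr A [idx i] := acc a` -/
  | store (A i a : ℕ)

def Instr.apply : Instr → State → State
  | .setIdx i c, s => { s with idx := Function.update s.idx i c }
  | .addIdx i j k, s => { s with idx := Function.update s.idx i (s.idx j + s.idx k) }
  | .subIdx i j k, s => { s with idx := Function.update s.idx i (s.idx j - s.idx k) }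
  | .cast a i, s => { s with acc := Function.update s.acc a (s.idx i : ℝ) }
  | .arith op a b c, s =>
      { s with acc := Function.update s.acc a (op.eval (s.acc b) (s.acc c)) }
  | .load a A i, s => { s with acc := Function.update s.acc a (s.arr A (s.idx i)) }
  | .store A i a, s =>
      { s with arr := Function.update s.arr A (Function.update (s.arr A) (s.idx i) (s.acc a)) }

inductive Test where
  /-- `idx i < idx j` -/
  | idxLt (i j : ℕ)
  /-- `acc a < acc b` -/
  | accLt (a b : ℕ)

def Test.Holds : Test → State → Prop
  | .idxLt i j, s => s.idx i < s.idx j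
  | .accLt a b, s => s.acc a < s.acc b

/-- Programs. -/
inductive Prog where
  | skip
  | instr (i : Instr)
  | seq (P Q : Prog)
  | ite (t : Test) (P Q : Prog)
  | loop (t : Test) (P : Prog)

/-- `Exec P s s' n`: started in `s`, the program `P` halts in `s'` after `n` steps. -/
inductive Exec : Prog → State → State → ℕ → Prop
  | skip (s : State) : Exec .skip s s 1
  | instr (i : Instr) (s : State) : Exec (.instr i) s (i.apply s) 1
  | seq {P Q : Prog} {s₁ s₂ s₃ : State} {n₁ n₂ : ℕ} :
      Exec P s₁ s₂ n₁ → Exec Q s₂ s₃ n₂ → Exec (.seq P Q) s₁ s₃ (n₁ + n₂)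
  | iteTrue {t : Test} {P Q : Prog} {s s' : State} {n : ℕ} :
      t.Holds s → Exec P s s' n → Exec (.ite t P Q) s s' (n + 1)
  | iteFalse {t : Test} {P Q : Prog} {s s' : State} {n : ℕ} :
      ¬ t.Holds s → Exec Q s s' n → Exec (.ite t P Q) s s' (n + 1)
  | loopDone {t : Test} {P : Prog} {s : State} :
      ¬ t.Holds s → Exec (.loop t P) s s 1
  | loopStep {t : Test} {P : Prog} {s₁ s₂ s₃ : State} {n₁ n₂ : ℕ} :
      t.Holds s₁ → Exec P s₁ s₂ n₁ → Exec (.loop t P) s₂ s₃ n₂ →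
        Exec (.loop t P) s₁ s₃ (n₁ + n₂ + 1)

/-! ### Online algorithms on the real RAM -/

/-- An online forecasting algorithm: `setup` is run once at the start; in each round, `predict` is
run after the context has arrived, and `update` after the forecast has been drawn and the label
has been revealed. The memory persists throughout. -/
structure Algorithm where
  setup : Prog
  predict : Prog
  update : Prog

/-- The initial state: the input is the dimension `d`, the horizon `T` and the norm bound `B`;
everything else is zero. -/
def initState (d T : ℕ) (B : ℝ) : State where
  idx := fun i => if i = 0 then d else if i = 1 then T else 0
  acc := fun a => if a = 0 then B else 0
  arr := fun _ _ => 0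

/-- The context arrives in array `0`. -/
def State.receiveContext {d : ℕ} (s : State) (x : Context d) : State :=
  { s with arr := Function.update s.arr 0 (fun k => if hk : k < d then (x ⟨k, hk⟩ : ℝ) else 0) }

/-- The index of the drawn forecast arrives in index register `3`, the label in real register
`1`. -/
def State.receiveOutcome (s : State) (p : ℕ) (y : ℝ) : State :=
  { s with idx := Function.update s.idx 3 p, acc := Function.update s.acc 1 y }

/-- On input `d`, `T`, `B`, the algorithm `A` carries out the learner `L` with forecasts
`{0, 1/m, …, 1}`, where the set-up and each of the `T` rounds take at most `τ` steps, whatever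
contexts and labels arrive and whatever forecasts are drawn. Here `σ π` is the state of the memory
after the history `π`. The set-up has to leave `m` in index register `2`, and `predict` has to
write the distribution into the entries `0, …, m` of array `1`. The steps of a round are those of
the two programs, `d` for reading the context and `m + 1` for drawing a forecast from the table of
its probabilities. -/
def Algorithm.Implements (A : Algorithm) (d T : ℕ) (B : ℝ) {m : ℕ} (L : Learner d m) (τ : ℕ) :
    Prop :=
  ∃ σ : History d m → State,
    (∃ n : ℕ, Exec A.setup (initState d T B) (σ []) n ∧ n ≤ τ ∧ (σ []).idx 2 = m) ∧
    ∀ π : History d m, π.length < T → ∀ x : Context d,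
      ∃ (s : State) (n₁ : ℕ), Exec A.predict ((σ π).receiveContext x) s n₁ ∧
        (∀ p : Fin (m + 1), s.arr 1 p = (L π x : Fin (m + 1) → ℝ) p) ∧
        ∀ (p : Fin (m + 1)) (y : unitInterval),
          ∃ n₂ : ℕ, Exec A.update (s.receiveOutcome p y) (σ (π ++ [⟨x, p, y⟩])) n₂ ∧
            d + n₁ + (m + 1) + n₂ ≤ τ

end OnlineMC

end

noncomputable section

namespace OnlineMC

/-! ### Total correctness with step counts -/

/-! For each forecast `p` let S_p be the sum of x_t (y_t - p) over the rounds with p_t = p. Since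
‖h‖₁ ≤ B, the contribution of `p` to the error is at most (B/T) ‖S_p‖₂, so it is enough to control
the sum of the norms ‖S_p‖₂. The norm is majorized by a quadratic: with any scale σ_p > 0, 2‖S_p‖ ≤
‖S_p‖²/σ_p + σ_p. The potential is the sum of the right-hand sides. Adding v x to S_p raises it by
2v⟨x, S_p⟩/σ_p + v²‖x‖²/σ_p (`Ledger.cost_push_self`), and replacing σ_p by ‖S_p‖²/σ_p merely swaps
its two terms. Hence the scale can be kept above the norm for free (`Ledger.Balanced.push`), and the
normalized correlations f(p) = ⟨x, S_p⟩/σ_p stay below √d (`Ledger.Balanced.abs_corr_le`). The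
learner randomizes between two neighbouring forecasts where f changes sign, so that the expectation
of f vanishes. The label is then irrelevant except through the mesh 1/m, and the linear term has
expectation O(√d/m) (`sum_weight_mul_le`). With m ≈ T^(1/3) and initial scale ≈ m√d, both the
initial potential and the total drift are O(m²√d) (`Ledger.Balanced.expected_potential_le`,
`expect_forecaster_le`), which gives an error O(B √d T^(-1/3)), even without the logarithm
(`error_bound`). A round only computes m + 1 inner products in dimension d, at cost O(md), far below
the permitted exponential bound (`forecaster_implements`, `time_bounds`). -/

/-- Started in `s`, the program `P` halts within `n` steps in a state that satisfies `Q`. -/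
def Runs (P : Prog) (s : State) (Q : State → Prop) (n : ℕ) : Prop :=
  ∃ (s' : State) (k : ℕ), Exec P s s' k ∧ k ≤ n ∧ Q s'

theorem Runs.mono {P : Prog} {s : State} {Q Q' : State → Prop} {n n' : ℕ}
    (h : Runs P s Q n) (hQ : ∀ s', Q s' → Q' s') (hn : n ≤ n') : Runs P s Q' n' := by
  obtain ⟨s', k, he, hk, hs⟩ := h
  exact ⟨s', k, he, hk.trans hn, hQ _ hs⟩

theorem Runs.seq {P P' : Prog} {s : State} {R Q : State → Prop} {n n' : ℕ}
    (h : Runs P s R n) (h' : ∀ s', R s' → Runs P' s' Q n') : Runs (.seq P P') s Q (n + n') := by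
  obtain ⟨s', k, he, hk, hs⟩ := h
  obtain ⟨s'', k', he', hk', hs'⟩ := h' s' hs
  exact ⟨s'', k + k', .seq he he', by omega, hs'⟩

theorem Runs.ite {t : Test} {P P' : Prog} {s : State} {Q : State → Prop} {n : ℕ}
    (h : t.Holds s → Runs P s Q n) (h' : ¬ t.Holds s → Runs P' s Q n) :
    Runs (.ite t P P') s Q (n + 1) := by
  by_cases ht : t.Holds s
  · obtain ⟨s', k, he, hk, hs⟩ := h ht
    exact ⟨s', k + 1, .iteTrue ht he, by omega, hs⟩
  · obtain ⟨s', k, he, hk, hs⟩ := h' ht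
    exact ⟨s', k + 1, .iteFalse ht he, by omega, hs⟩

/-- The invariant is indexed by the number of completed passes, so it determines the number of
iterations exactly. Each pass pays one extra step for its test, and the last, failing test pays one
more. -/
theorem Runs.loop {t : Test} {P : Prog} {I : ℕ → State → Prop} {K c : ℕ}
    (hstep : ∀ k < K, ∀ s, I k s → t.Holds s ∧ Runs P s (I (k + 1)) c)
    (hend : ∀ s, I K s → ¬ t.Holds s) {s : State} (h : I 0 s) :
    Runs (.loop t P) s (I K) (K * (c + 1) + 1) := by
  suffices H : ∀ j k, k + j = K → ∀ s, I k s → Runs (.loop t P) s (I K) (j * (c + 1) + 1) from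
    H K 0 (by omega) s h
  intro j
  induction j with
  | zero =>
    rintro k rfl s hs
    exact ⟨s, 1, .loopDone (hend s hs), by omega, hs⟩
  | succ j ih =>
    intro k hk s hs
    obtain ⟨ht, s', n, he, hn, hs'⟩ := hstep k (by omega) s hs
    obtain ⟨s'', n', he', hn', hs''⟩ := ih (k + 1) (by omega) s' hs'
    exact ⟨s'', n + n' + 1, .loopStep ht he he', by rw [Nat.succ_mul]; omega, hs''⟩

/-- Straight-line code. -/
def block : List Instr → Prog
  | [] => .skip
  | i :: l => .seq (.instr i) (block l)

theorem Runs.block {l : List Instr} {s : State} {Q : State → Prop}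
    (h : Q (l.foldl (fun s i => i.apply s) s)) : Runs (block l) s Q (l.length + 1) := by
  induction l generalizing s with
  | nil => exact ⟨s, 1, .skip s, by simp, h⟩
  | cons i l ih =>
    obtain ⟨s', k, he, hk, hs⟩ := ih (s := i.apply s) h
    exact ⟨s', 1 + k, .seq (.instr i s) he, by simp; omega, hs⟩

/-! ### The program

Index registers: `4` holds `1`, `8` holds `m + 1`, and `5`, `6`, `7` are counters. Real register `2`
holds the initial scale. Array `2` holds the rows of signed sums one after the other, array `3` the
excesses of the scales over the initial scale, and array `4` the normalized correlations of the rows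
with the current context. -/

/-- Linear search for the least `m` whose cube is at least `T`, with the cube held in real register
`5`. -/
def searchDiscretization : Prog :=
  .seq (block [.setIdx 4 1, .setIdx 2 1, .cast 3 1, .cast 4 2, .arith .mul 5 4 4,
      .arith .mul 5 5 4])
    (.loop (.accLt 5 3) (block [.addIdx 2 2 4, .cast 4 2, .arith .mul 5 4 4, .arith .mul 5 5 4]))

/-- Linear search for the least `s` with `d ≤ s²`, an integer substitute for √d. The initial scale
is then `m * s`. -/
def searchScale : Prog :=
  .seq (block [.addIdx 8 2 4, .setIdx 5 1, .cast 3 0, .cast 6 5, .arith .mul 5 6 6])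
    (.seq (.loop (.accLt 5 3) (block [.addIdx 5 5 4, .cast 6 5, .arith .mul 5 6 6]))
      (block [.arith .mul 2 4 6]))

/-- Index register `6` runs through array `2` without being reset, so each row begins where the
previous one ended. Entry `p` of the output distribution is cleared on the way. Subtracting a real
register from itself produces zero. -/
def correlate : Prog :=
  .seq (block [.setIdx 7 0, .arith .sub 3 3 3])
    (.seq (.loop (.idxLt 7 0) (block [.load 4 0 7, .load 5 2 6, .arith .mul 4 4 5,
        .arith .add 3 3 4, .addIdx 7 7 4, .addIdx 6 6 4]))
      (block [.load 4 3 5, .arith .add 4 4 2, .arith .div 3 3 4, .store 4 5 3, .arith .sub 5 5 5,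
        .store 1 5 5, .addIdx 5 5 4]))

def correlateAll : Prog :=
  .seq (block [.setIdx 5 0, .setIdx 6 0]) (.loop (.idxLt 5 8) correlate)

/-- The loop tests no index bound: entry `m + 1` of array `4` is never written and stays zero, so it
stops the search. -/
def searchCrossing : Prog :=
  .seq (block [.setIdx 5 0, .load 3 4 5, .arith .sub 6 6 6])
    (.loop (.accLt 6 3) (block [.addIdx 5 5 4, .arith .add 4 3 6, .load 3 4 5]))

def writeWeights : Prog :=
  .ite (.idxLt 5 4) (block [.cast 5 4, .store 1 5 5])
    (.ite (.idxLt 2 5) (block [.cast 5 4, .store 1 2 5])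
      (block [.arith .sub 5 4 3, .arith .div 6 4 5, .cast 7 4, .arith .sub 7 7 6, .subIdx 6 5 4,
        .store 1 6 7, .store 1 5 6]))

/-- Indices cannot be multiplied, so the offset `p * d` is obtained by adding `d` repeatedly. -/
def locateRow : Prog :=
  .seq (block [.cast 3 3, .cast 4 2, .arith .div 3 3 4, .arith .sub 3 1 3, .setIdx 6 0,
      .setIdx 7 0])
    (.loop (.idxLt 7 3) (block [.addIdx 6 6 0, .addIdx 7 7 4]))

def updateRow : Prog :=
  .seq (block [.setIdx 7 0, .arith .sub 4 4 4])
    (.loop (.idxLt 7 0) (block [.load 5 0 7, .arith .mul 5 5 3, .load 6 2 6, .arith .add 6 6 5,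
      .store 2 6 6, .arith .mul 6 6 6, .arith .add 4 4 6, .addIdx 7 7 4, .addIdx 6 6 4]))

def updateScale : Prog :=
  .seq (block [.load 5 3 3, .arith .add 5 5 2, .arith .mul 6 5 5])
    (.ite (.accLt 6 4) (block [.arith .div 5 4 5, .arith .sub 5 5 2, .store 3 3 5]) (block []))

def linearForecaster : Algorithm where
  setup := .seq searchDiscretization searchScale
  predict := .seq correlateAll (.seq searchCrossing writeWeights)
  update := .seq locateRow (.seq updateRow updateScale)

/-! ### What the program computes -/

/-- The context as a sequence that vanishes from `d` on. -/
def pad {d : ℕ} (x : Context d) : ℕ → ℝ := fun k => if hk : k < d then (x ⟨k, hk⟩ : ℝ) else 0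

/-- For each forecast, the vector of signed sums and its scale. -/
structure Ledger where
  row : ℕ → ℕ → ℝ
  scale : ℕ → ℝ

/-- Adds `v • x` to row `p` and, if the row has outgrown its scale, enlarges the scale. -/
def Ledger.push (d : ℕ) (M : Ledger) (x : ℕ → ℝ) (p : ℕ) (v : ℝ) : Ledger where
  row := Function.update M.row p fun i => M.row p i + x i * v
  scale := Function.update M.scale p <|
    if M.scale p ^ 2 < ∑ i ∈ Finset.range d, (M.row p i + x i * v) ^ 2 then
      (∑ i ∈ Finset.range d, (M.row p i + x i * v) ^ 2) / M.scale p
    else M.scale p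

/-- The ledger after a history, with initial scale `c`. -/
def ledger (c : ℝ) {d m : ℕ} (π : History d m) : Ledger :=
  π.foldl (fun M r => M.push d (pad r.context) r.pred ((r.label : ℝ) - (r.pred : ℕ) / (m : ℝ)))
    ⟨0, fun _ => c⟩

theorem ledger_append (c : ℝ) {d m : ℕ} (π : History d m) (r : Round d m) :
    ledger c (π ++ [r]) = (ledger c π).push d (pad r.context) r.pred
      ((r.label : ℝ) - (r.pred : ℕ) / (m : ℝ)) := by
  simp [ledger]

/-- The normalized correlation of row `p` with `x`. -/
def Ledger.corr (d : ℕ) (M : Ledger) (x : ℕ → ℝ) (p : ℕ) : ℝ :=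
  (∑ i ∈ Finset.range d, x i * M.row p i) / M.scale p

theorem exists_crossing (m : ℕ) (f : ℕ → ℝ) : ∃ k, m < k ∨ f k ≤ 0 := ⟨m + 1, by simp⟩

open Classical in
/-- The first `k` at which `f` is not positive, or `m + 1` if there is none up to `m`. -/
def crossing (m : ℕ) (f : ℕ → ℝ) : ℕ := Nat.find (exists_crossing m f)

theorem crossing_le (m : ℕ) (f : ℕ → ℝ) : crossing m f ≤ m + 1 := by
  classical
  exact Nat.find_min' _ (by simp)

theorem crossing_spec (m : ℕ) (f : ℕ → ℝ) : m < crossing m f ∨ f (crossing m f) ≤ 0 := by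
  classical
  exact Nat.find_spec (exists_crossing m f)

theorem pos_of_lt_crossing {m : ℕ} {f : ℕ → ℝ} {k : ℕ} (h : k < crossing m f) : 0 < f k := by
  classical
  have := Nat.find_min (exists_crossing m f) h
  push Not at this
  exact this.2

/-- Weights on `{0, …, m}`, concentrated on the two points around the first sign change of `f`. -/
def weight (m : ℕ) (f : ℕ → ℝ) : ℕ → ℝ :=
  if crossing m f = 0 then Pi.single 0 1
  else if m < crossing m f then Pi.single m 1
  else
    Function.update
      (Pi.single (crossing m f - 1)
        (1 - f (crossing m f - 1) / (f (crossing m f - 1) - f (crossing m f))))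
      (crossing m f) (f (crossing m f - 1) / (f (crossing m f - 1) - f (crossing m f)))

/-! ### Correctness of the program -/

/-- The registers that keep their values during all rounds. -/
structure Regs (d m : ℕ) (c : ℝ) (s : State) : Prop where
  dim : s.idx 0 = d
  disc : s.idx 2 = m
  one : s.idx 4 = 1
  succ : s.idx 8 = m + 1
  scale : s.acc 2 = c

/-- The memory holds the ledger. -/
structure Holds (d m : ℕ) (c : ℝ) (M : Ledger) (s : State) : Prop where
  regs : Regs d m c s
  row : ∀ p, ∀ i < d, s.arr 2 (p * d + i) = M.row p i
  scale : ∀ p, s.arr 3 p + c = M.scale p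
  sentinel : s.arr 4 (m + 1) = 0

theorem runs_search {T m : ℕ} (d : ℕ) (B : ℝ) (hm : 1 ≤ m) (hT : T ≤ m ^ 3)
    (hmin : ∀ k, 1 ≤ k → k < m → k ^ 3 < T) :
    Runs searchDiscretization (initState d T B)
      (fun s => s.idx 0 = d ∧ s.idx 2 = m ∧ s.idx 4 = 1 ∧ s.acc 4 = m ∧ s.arr = 0)
      (7 * m + 10) := by
  let I : ℕ → State → Prop := fun k s => s.idx 0 = d ∧ s.idx 2 = k + 1 ∧ s.idx 4 = 1 ∧
    s.acc 3 = T ∧ s.acc 4 = ((k + 1 : ℕ) : ℝ) ∧ s.acc 5 = ((k + 1 : ℕ) : ℝ) ^ 3 ∧ s.arr = 0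
  refine Runs.mono (Runs.seq (R := I 0) (Runs.block ?_) fun s hs =>
    Runs.loop (I := I) (K := m - 1) (c := 5) ?_ ?_ hs) ?_ (n := 7 + ((m - 1) * 6 + 1)) (by omega)
  · simp [I, initState, Instr.apply, ArithOp.eval]
    rfl
  · rintro k hk s ⟨h0, h2, h4, h3, h4', h5, ha⟩
    refine ⟨?_, Runs.block ?_⟩
    · simp only [Test.Holds, h3, h5]
      exact_mod_cast hmin (k + 1) (by omega) (by omega)
    · simp [I, Instr.apply, ArithOp.eval, h0, h2, h4, h3, ha]
      ring
  · rintro s ⟨h0, h2, h4, h3, h4', h5, ha⟩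
    simp only [Test.Holds, h3, h5, not_lt]
    rw [Nat.sub_add_cancel hm]
    exact_mod_cast hT
  · rintro s ⟨h0, h2, h4, h3, h4', h5, ha⟩
    rw [Nat.sub_add_cancel hm] at h2 h4'
    exact ⟨h0, h2, h4, h4', ha⟩

theorem runs_searchScale {d m s : ℕ} (hs : 1 ≤ s) (hd : d ≤ s ^ 2)
    (hmin : ∀ k, 1 ≤ k → k < s → k ^ 2 < d) {st : State}
    (h : st.idx 0 = d ∧ st.idx 2 = m ∧ st.idx 4 = 1 ∧ st.acc 4 = m ∧ st.arr = 0) :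
    Runs searchScale st (fun s' => Regs d m (m * s) s' ∧ s'.arr = 0) (6 * s + 10) := by
  obtain ⟨i0, i2, i4, a4, ha⟩ := h
  let I : ℕ → State → Prop := fun k s => s.idx 0 = d ∧ s.idx 2 = m ∧ s.idx 4 = 1 ∧
    s.idx 8 = m + 1 ∧ s.idx 5 = k + 1 ∧ s.acc 4 = m ∧
    s.acc 3 = d ∧ s.acc 6 = ((k + 1 : ℕ) : ℝ) ∧ s.acc 5 = ((k + 1 : ℕ) : ℝ) ^ 2 ∧ s.arr = 0
  refine Runs.mono (Runs.seq (R := I 0) (Runs.block ?_) fun s' hs' => Runs.seq (R := I (s - 1))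
    (Runs.loop (I := I) (K := s - 1) (c := 4) ?_ ?_ hs') fun s'' hs'' => Runs.block ?_)
    (fun _ h => h) (n := 6 + ((s - 1) * 5 + 1 + 2)) (by omega)
  · simp [I, Instr.apply, ArithOp.eval, i0, i2, i4, a4, ha]
  · rintro k hk s ⟨h0, h2, h4, h8, h5, h4', h3, h6, h5', ha⟩
    refine ⟨?_, Runs.block ?_⟩
    · simp only [Test.Holds, h3, h5']
      exact_mod_cast hmin (k + 1) (by omega) (by omega)
    · simp [I, Instr.apply, ArithOp.eval, h0, h2, h4, h8, h5, h4', h3, ha]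
      ring
  · rintro st' ⟨h0, h2, h4, h8, h5, h4', h3, h6, h5', ha⟩
    simp only [Test.Holds, h3, h5', not_lt]
    rw [Nat.sub_add_cancel hs]
    exact_mod_cast hd
  · obtain ⟨h0, h2, h4, h8, h5, h4', h3, h6, h5', ha⟩ := hs''
    rw [Nat.sub_add_cancel hs] at h6
    refine ⟨⟨?_, ?_, ?_, ?_, ?_⟩, ?_⟩ <;>
      simp [Instr.apply, ArithOp.eval, h0, h2, h4, h8, h4', h6, ha]

theorem runs_setup {d T m s : ℕ} (B : ℝ) (hm : 1 ≤ m) (hT : T ≤ m ^ 3)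
    (hmin : ∀ k, 1 ≤ k → k < m → k ^ 3 < T) (hs : 1 ≤ s) (hd : d ≤ s ^ 2)
    (hmin' : ∀ k, 1 ≤ k → k < s → k ^ 2 < d) :
    Runs linearForecaster.setup (initState d T B)
      (fun s' => Holds d m (m * s) ⟨0, fun _ => m * s⟩ s') (7 * m + 6 * s + 20) := by
  refine ((runs_search d B hm hT hmin).seq fun st h => runs_searchScale hs hd hmin' h).mono
    ?_ (by omega)
  rintro s' ⟨hr, ha⟩
  -- Because array `3` stores excesses over the initial scale, the untouched zero memory already
  -- represents the empty ledger.
  exact ⟨hr, by simp [ha], by simp [ha], by simp [ha]⟩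

theorem runs_correlate {d m : ℕ} {c : ℝ} {M : Ledger} {x : ℕ → ℝ} {p : ℕ} (hp : p ≤ m) {s : State}
    (hs : Holds d m c M s) (h0 : s.arr 0 = x) (h5 : s.idx 5 = p) (h6 : s.idx 6 = p * d)
    (h4 : ∀ q < p, s.arr 4 q = M.corr d x q) (h1 : ∀ q < p, s.arr 1 q = 0) :
    Runs correlate s (fun s' => Holds d m c M s' ∧ s'.arr 0 = x ∧ s'.idx 5 = p + 1 ∧
      s'.idx 6 = (p + 1) * d ∧ (∀ q < p + 1, s'.arr 4 q = M.corr d x q) ∧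
      ∀ q < p + 1, s'.arr 1 q = 0) (8 * d + 12) := by
  let I : ℕ → State → Prop := fun k s' => Regs d m c s' ∧ s'.arr = s.arr ∧ s'.idx 5 = p ∧
    s'.idx 6 = p * d + k ∧ s'.idx 7 = k ∧
    s'.acc 3 = ∑ i ∈ Finset.range k, x i * s.arr 2 (p * d + i)
  obtain ⟨⟨r0, r2, r4, r8, ra⟩, hrow, hscale, hsent⟩ := hs
  refine Runs.mono (Runs.seq (R := I 0) (Runs.block ?_) fun s' hs' => Runs.seq (R := I d)
    (Runs.loop (I := I) (K := d) (c := 7) ?_ ?_ hs') fun s'' hs'' => Runs.block ?_)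
    (fun _ h => h) (n := 3 + (d * 8 + 1 + 8)) (by omega)
  · refine ⟨⟨?_, ?_, ?_, ?_, ?_⟩, ?_⟩ <;>
      simp [Instr.apply, ArithOp.eval, r0, r2, r4, r8, ra, h5, h6]
  · rintro k hk s' ⟨⟨r0, r2, r4, r8, ra⟩, h, h5, h6, h7, h3⟩
    refine ⟨by simpa [Test.Holds, h7, r0] using hk, Runs.block ⟨⟨?_, ?_, ?_, ?_, ?_⟩, ?_⟩⟩ <;>
      simp [Instr.apply, ArithOp.eval, r0, r2, r4, r8, ra, h, h0, h5, h6, h7, h3,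
        Finset.sum_range_succ, add_assoc]
  · rintro s' ⟨⟨r0, r2, r4, r8, ra⟩, h, h5, h6, h7, h3⟩
    simp [Test.Holds, h7, r0]
  · obtain ⟨⟨r0, r2, r4, r8, ra⟩, h, h5, h6, h7, h3⟩ := hs''
    rw [Finset.sum_congr rfl fun i hi => by rw [hrow p i (Finset.mem_range.1 hi)]] at h3
    refine ⟨⟨⟨?_, ?_, ?_, ?_, ?_⟩, ?_, ?_, ?_⟩, ?_, ?_, ?_, ?_, ?_⟩
    · simp [Instr.apply, r0]
    · simp [Instr.apply, r2]
    · simp [Instr.apply, r4]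
    · simp [Instr.apply, r8]
    · simp [Instr.apply, ra]
    · simpa [Instr.apply, h] using hrow
    · simpa [Instr.apply, h] using hscale
    · have : m + 1 ≠ p := by omega
      simp [Instr.apply, h, h5, this, hsent]
    · simp [Instr.apply, h, h0]
    · simp [Instr.apply, h5, r4]
    · simp [Instr.apply, h6]; ring
    · intro q hq
      rcases Nat.lt_succ_iff_lt_or_eq.1 hq with hq | rfl
      · simp [Instr.apply, h, h5, hq.ne, h4 q hq]
      · simp [Instr.apply, ArithOp.eval, h, h5, h3, ra, hscale, Ledger.corr]
    · intro q hq
      rcases Nat.lt_succ_iff_lt_or_eq.1 hq with hq | rfl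
      · simp [Instr.apply, h, h5, hq.ne, h1 q hq]
      · simp [Instr.apply, ArithOp.eval, h5]

theorem runs_correlateAll {d m : ℕ} {c : ℝ} {M : Ledger} {x : ℕ → ℝ} {s : State}
    (hs : Holds d m c M s) (h0 : s.arr 0 = x) :
    Runs correlateAll s (fun s' => Holds d m c M s' ∧ s'.arr 0 = x ∧
      (∀ q < m + 1, s'.arr 4 q = M.corr d x q) ∧ ∀ q < m + 1, s'.arr 1 q = 0)
      ((m + 1) * (8 * d + 13) + 4) := by
  let I : ℕ → State → Prop := fun k s' => Holds d m c M s' ∧ s'.arr 0 = x ∧ s'.idx 5 = k ∧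
      s'.idx 6 = k * d ∧ (∀ q < k, s'.arr 4 q = M.corr d x q) ∧ ∀ q < k, s'.arr 1 q = 0
  refine Runs.mono (Runs.seq (R := I 0) (Runs.block ?_) fun s' hs' =>
    Runs.loop (I := I) (K := m + 1) (c := 8 * d + 12) ?_ ?_ hs')
    ?_ (n := 3 + ((m + 1) * (8 * d + 13) + 1)) (by omega)
  · obtain ⟨⟨r0, r2, r4, r8, ra⟩, hrow, hscale, hsent⟩ := hs
    refine ⟨⟨⟨?_, ?_, ?_, ?_, ?_⟩, ?_, ?_, ?_⟩, ?_⟩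
    any_goals simp [Instr.apply, r0, r2, r4, r8, ra, hsent, h0]
    · simpa using hrow
    · simpa using hscale
  · rintro k hk s' ⟨hs, h0, h5, h6, h4, h1⟩
    exact ⟨by simpa [Test.Holds, h5, hs.regs.succ] using hk,
      runs_correlate (by omega) hs h0 h5 h6 h4 h1⟩
  · rintro s' ⟨hs, h0, h5, h6, h4, h1⟩
    simp [Test.Holds, h5, hs.regs.succ]
  · rintro s' ⟨hs, h0, h5, h6, h4, h1⟩
    exact ⟨hs, h0, h4, h1⟩

theorem runs_searchCrossing {d m : ℕ} {c : ℝ} {M : Ledger} {x : ℕ → ℝ} {f : ℕ → ℝ} {s : State}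
    (hs : Holds d m c M s) (h0 : s.arr 0 = x) (h4 : ∀ q < m + 1, s.arr 4 q = f q)
    (h1 : ∀ q < m + 1, s.arr 1 q = 0) :
    Runs searchCrossing s (fun s' => Holds d m c M s' ∧ s'.arr 0 = x ∧
      (∀ q < m + 1, s'.arr 1 q = 0) ∧ s'.idx 5 = crossing m f ∧
      (crossing m f ≤ m → s'.acc 3 = f (crossing m f)) ∧
      (crossing m f ≠ 0 → s'.acc 4 = f (crossing m f - 1))) (5 * m + 10) := by
  let I : ℕ → State → Prop := fun k s' => Regs d m c s' ∧ s'.arr = s.arr ∧ s'.idx 5 = k ∧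
    s'.acc 6 = 0 ∧ s'.acc 3 = s.arr 4 k ∧ (k ≠ 0 → s'.acc 4 = s.arr 4 (k - 1))
  obtain ⟨⟨r0, r2, r4, r8, ra⟩, hrow, hscale, hsent⟩ := hs
  have hle := crossing_le m f
  refine Runs.mono (Runs.seq (R := I 0) (Runs.block ?_) fun s' hs' =>
    Runs.loop (I := I) (K := crossing m f) (c := 4) ?_ ?_ hs')
    ?_ (n := 4 + (crossing m f * 5 + 1)) (by omega)
  · refine ⟨⟨?_, ?_, ?_, ?_, ?_⟩, ?_⟩ <;>
      simp [Instr.apply, ArithOp.eval, r0, r2, r4, r8, ra]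
  · rintro k hk s' ⟨⟨r0, r2, r4, r8, ra⟩, h, h5, h6, h3, h4'⟩
    refine ⟨?_, Runs.block ⟨⟨?_, ?_, ?_, ?_, ?_⟩, ?_⟩⟩
    · simpa [Test.Holds, h6, h3, h4 k (by omega)] using pos_of_lt_crossing hk
    all_goals simp [Instr.apply, ArithOp.eval, r0, r2, r4, r8, ra, h, h5, h6, h3]
  · rintro s' ⟨⟨r0, r2, r4, r8, ra⟩, h, h5, h6, h3, h4'⟩
    simp only [Test.Holds, h6, h3, not_lt]
    -- The search halts either at a genuine nonpositive value or at the zero sentinel in position `m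
    -- + 1`.
    rcases hle.lt_or_eq with hlt | heq
    · rw [h4 _ hlt]
      exact (crossing_spec m f).resolve_left (by omega)
    · rw [heq, hsent]
  · rintro s' ⟨hr, h, h5, h6, h3, h4'⟩
    refine ⟨⟨hr, by rwa [h], by rwa [h], by rwa [h]⟩, by rwa [h], by rwa [h], h5, fun hk => ?_,
      fun hk => ?_⟩
    · rw [h3, h4 _ (by omega)]
    · rw [h4' hk, h4 _ (by omega)]

theorem runs_writeWeights {d m : ℕ} {c : ℝ} {M : Ledger} {x : ℕ → ℝ} {f : ℕ → ℝ} {s : State}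
    (h : Holds d m c M s ∧ s.arr 0 = x ∧ (∀ q < m + 1, s.arr 1 q = 0) ∧ s.idx 5 = crossing m f ∧
      (crossing m f ≤ m → s.acc 3 = f (crossing m f)) ∧
      (crossing m f ≠ 0 → s.acc 4 = f (crossing m f - 1))) :
    Runs writeWeights s (fun s' => Holds d m c M s' ∧ s'.arr 0 = x ∧
      ∀ q < m + 1, s'.arr 1 q = weight m f q) 10 := by
  obtain ⟨⟨⟨r0, r2, r4, r8, ra⟩, hrow, hscale, hsent⟩, h0, h1, h5, h3, h4⟩ := h
  refine Runs.ite (n := 9) (fun ht => ?_) fun ht =>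
    Runs.ite (n := 8) (fun ht' => ?_) fun ht' => ?_
  · refine (Runs.block ?_).mono (fun _ h => h) (n := 3) (by omega)
    replace ht : crossing m f = 0 := by simpa [Test.Holds, h5, r4] using ht
    refine ⟨⟨⟨?_, ?_, ?_, ?_, ?_⟩, ?_, ?_, ?_⟩, ?_, fun q hq => ?_⟩
    any_goals simp [Instr.apply, r0, r2, r4, r8, ra, hsent, h0]
    · simpa using hrow
    · simpa using hscale
    · rw [weight, if_pos ht, h5, ht, Function.update_apply, Pi.single_apply, h1 q hq]
  · refine (Runs.block ?_).mono (fun _ h => h) (n := 3) (by omega)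
    replace ht : ¬ crossing m f = 0 := by simpa [Test.Holds, h5, r4] using ht
    replace ht' : m < crossing m f := by simpa [Test.Holds, h5, r2] using ht'
    refine ⟨⟨⟨?_, ?_, ?_, ?_, ?_⟩, ?_, ?_, ?_⟩, ?_, fun q hq => ?_⟩
    any_goals simp [Instr.apply, r0, r2, r4, r8, ra, hsent, h0]
    · simpa using hrow
    · simpa using hscale
    · rw [weight, if_neg ht, if_pos ht', Function.update_apply, Pi.single_apply, h1 q hq]
  · refine (Runs.block ?_).mono (fun _ h => h) (n := 8) (by omega)
    replace ht : ¬ crossing m f = 0 := by simpa [Test.Holds, h5, r4] using ht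
    replace ht' : ¬ m < crossing m f := by simpa [Test.Holds, h5, r2] using ht'
    specialize h3 (by omega)
    specialize h4 ht
    refine ⟨⟨⟨?_, ?_, ?_, ?_, ?_⟩, ?_, ?_, ?_⟩, ?_, fun q hq => ?_⟩
    any_goals simp [Instr.apply, r0, r2, r4, r8, ra, hsent, h0]
    · simpa using hrow
    · simpa using hscale
    · rw [weight, if_neg ht, if_neg ht', h5, h3, h4]
      simp only [ArithOp.eval, Function.update_apply, Pi.single_apply, h1 q hq]

theorem runs_predict {d m : ℕ} {c : ℝ} {M : Ledger} (x : Context d) {s : State}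
    (hs : Holds d m c M s) :
    Runs linearForecaster.predict (s.receiveContext x) (fun s' => Holds d m c M s' ∧
      s'.arr 0 = pad x ∧ ∀ q < m + 1, s'.arr 1 q = weight m (M.corr d (pad x)) q)
      ((m + 1) * (8 * d + 13) + 5 * m + 24) := by
  have hs' : Holds d m c M (s.receiveContext x) := by
    obtain ⟨⟨r0, r2, r4, r8, ra⟩, hrow, hscale, hsent⟩ := hs
    refine ⟨⟨r0, r2, r4, r8, ra⟩, ?_, ?_, ?_⟩ <;> simpa [State.receiveContext]
  refine ((runs_correlateAll hs' rfl).seq fun s₁ h₁ =>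
    (runs_searchCrossing h₁.1 h₁.2.1 h₁.2.2.1 h₁.2.2.2).seq fun s₂ h₂ => runs_writeWeights h₂).mono
    (fun _ h => h) (by omega)

theorem runs_locateRow {d m : ℕ} {c : ℝ} {M : Ledger} {x : ℕ → ℝ} {p : ℕ} {y : ℝ} {s : State}
    (hs : Holds d m c M s) (h0 : s.arr 0 = x) (h3 : s.idx 3 = p) (h1 : s.acc 1 = y) :
    Runs locateRow s (fun s' => Holds d m c M s' ∧ s'.arr 0 = x ∧ s'.idx 3 = p ∧
      s'.idx 6 = p * d ∧ s'.acc 3 = y - p / m) (4 * p + 8) := by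
  obtain ⟨⟨r0, r2, r4, r8, ra⟩, hrow, hscale, hsent⟩ := hs
  let I : ℕ → State → Prop := fun k s' => Regs d m c s' ∧ s'.arr = s.arr ∧ s'.idx 3 = p ∧
    s'.idx 6 = k * d ∧ s'.idx 7 = k ∧ s'.acc 3 = y - p / m
  refine Runs.mono (Runs.seq (R := I 0) (Runs.block ?_) fun s' hs' =>
    Runs.loop (I := I) (K := p) (c := 3) ?_ ?_ hs') ?_ (n := 7 + (p * 4 + 1)) (by omega)
  · refine ⟨⟨?_, ?_, ?_, ?_, ?_⟩, ?_⟩ <;>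
      simp [Instr.apply, ArithOp.eval, r0, r2, r4, r8, ra, h3, h1]
  · rintro k hk s' ⟨⟨r0, r2, r4, r8, ra⟩, h, h3, h6, h7, h3'⟩
    refine ⟨by simpa [Test.Holds, h7, h3] using hk, Runs.block ⟨⟨?_, ?_, ?_, ?_, ?_⟩, ?_⟩⟩ <;>
      simp [Instr.apply, r0, r2, r4, r8, ra, h, h3, h6, h7, h3', add_mul]
  · rintro s' ⟨⟨r0, r2, r4, r8, ra⟩, h, h3, h6, h7, h3'⟩
    simp [Test.Holds, h7, h3]
  · rintro s' ⟨hr, h, h3, h6, h7, h3'⟩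
    exact ⟨⟨hr, by rwa [h], by rwa [h], by rwa [h]⟩, by rwa [h], h3, h6, h3'⟩

theorem runs_updateRow {d m : ℕ} {c : ℝ} {M : Ledger} {x : ℕ → ℝ} {p : ℕ} {v : ℝ} {s : State}
    (h : Holds d m c M s ∧ s.arr 0 = x ∧ s.idx 3 = p ∧ s.idx 6 = p * d ∧ s.acc 3 = v) :
    Runs updateRow s (fun s' => Holds d m c ⟨(M.push d x p v).row, M.scale⟩ s' ∧ s'.idx 3 = p ∧
      s'.acc 4 = ∑ i ∈ Finset.range d, (M.row p i + x i * v) ^ 2) (11 * d + 8) := by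
  obtain ⟨⟨⟨r0, r2, r4, r8, ra⟩, hrow, hscale, hsent⟩, h0, h3, h6, h3'⟩ := h
  let I : ℕ → State → Prop := fun k s' => Regs d m c s' ∧ s'.arr 0 = x ∧ s'.arr 3 = s.arr 3 ∧
    s'.arr 4 = s.arr 4 ∧
    -- After `k` passes, exactly the first `k` cells of row `p` have been changed; the formula
    -- covers the whole array at once, so the other rows need no separate invariant.
    (∀ l, s'.arr 2 l = s.arr 2 l + if p * d ≤ l ∧ l < p * d + k then x (l - p * d) * v else 0) ∧
    s'.idx 3 = p ∧ s'.idx 6 = p * d + k ∧ s'.idx 7 = k ∧ s'.acc 3 = v ∧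
    s'.acc 4 = ∑ i ∈ Finset.range k, (s.arr 2 (p * d + i) + x i * v) ^ 2
  refine Runs.mono (Runs.seq (R := I 0) (Runs.block ?_) fun s' hs' =>
    Runs.loop (I := I) (K := d) (c := 10) ?_ ?_ hs') ?_ (n := 3 + (d * 11 + 1)) (by omega)
  · refine ⟨⟨?_, ?_, ?_, ?_, ?_⟩, ?_⟩ <;>
      simp [Instr.apply, ArithOp.eval, r0, r2, r4, r8, ra, h0, h3, h6, h3']
  · rintro k hk s' ⟨⟨r0, r2, r4, r8, ra⟩, h0, ha3, ha4, ha2, h3, h6, h7, h3', h4⟩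
    refine ⟨by simpa [Test.Holds, h7, r0] using hk,
      Runs.block ⟨⟨?_, ?_, ?_, ?_, ?_⟩, ?_, ?_, ?_, fun l => ?_, ?_, ?_, ?_, ?_, ?_⟩⟩
    any_goals simp [Instr.apply, ArithOp.eval, r0, r2, r4, r8, ra, h0, ha3, ha4, h3, h6, h7, h3',
      add_assoc]
    · rcases eq_or_ne l (p * d + k) with rfl | hl
      · simp [ha2]
      · rw [Function.update_of_ne hl, ha2]
        congr 1
        exact if_congr (by omega) rfl rfl
    · simp [h4, ha2, Finset.sum_range_succ, sq]
  · rintro s' ⟨⟨r0, r2, r4, r8, ra⟩, h0, ha3, ha4, ha2, h3, h6, h7, h3', h4⟩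
    simp [Test.Holds, h7, r0]
  · rintro s' ⟨hr, h0, ha3, ha4, ha2, h3, h6, h7, h3', h4⟩
    refine ⟨⟨hr, fun q i hi => ?_, by rwa [ha3], by rwa [ha4]⟩, h3, ?_⟩
    · rw [ha2, hrow q i hi]
      rcases lt_trichotomy q p with hq | rfl | hq
      -- Distinct rows occupy disjoint segments of length `d`.
      · have : (q + 1) * d ≤ p * d := Nat.mul_le_mul_right d hq
        rw [if_neg (by rw [add_mul] at this; omega)]
        simp [Ledger.push, hq.ne]
      · simp [Ledger.push, hi]
      · have : (p + 1) * d ≤ q * d := Nat.mul_le_mul_right d hq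
        rw [if_neg (by rw [add_mul] at this; omega)]
        simp [Ledger.push, hq.ne']
    · rw [h4]
      exact Finset.sum_congr rfl fun i hi => by rw [hrow p i (Finset.mem_range.1 hi)]

theorem runs_updateScale {d m : ℕ} {c : ℝ} {M : Ledger} {x : ℕ → ℝ} {p : ℕ} {v : ℝ} {s : State}
    (h : Holds d m c ⟨(M.push d x p v).row, M.scale⟩ s ∧ s.idx 3 = p ∧
      s.acc 4 = ∑ i ∈ Finset.range d, (M.row p i + x i * v) ^ 2) :
    Runs updateScale s (fun s' => Holds d m c (M.push d x p v) s') 10 := by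
  obtain ⟨⟨⟨r0, r2, r4, r8, ra⟩, hrow, hscale, hsent⟩, h3, h4⟩ := h
  refine Runs.mono (Runs.seq (n := 4) (R := fun s' => Regs d m c s' ∧ s'.arr = s.arr ∧
    s'.idx 3 = p ∧ s'.acc 4 = s.acc 4 ∧ s'.acc 5 = M.scale p ∧ s'.acc 6 = M.scale p ^ 2)
    (Runs.block ?_) fun s' hs' => Runs.ite (n := 4) (fun ht => ?_) fun ht => ?_)
    (fun _ h => h) (by omega)
  · refine ⟨⟨?_, ?_, ?_, ?_, ?_⟩, ?_⟩ <;>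
      simp [Instr.apply, ArithOp.eval, r0, r2, r4, r8, ra, h3, hscale, sq]
  · obtain ⟨⟨r0, r2, r4, r8, ra⟩, ha, h3', h4', h5, h6⟩ := hs'
    simp only [Test.Holds, h6, h4', h4] at ht
    refine Runs.block ⟨⟨?_, ?_, ?_, ?_, ?_⟩, ?_, fun q => ?_, ?_⟩
    any_goals simp [Instr.apply, r0, r2, r4, r8, ra, ha, hsent]
    · simpa using hrow
    · rcases eq_or_ne q p with rfl | hq
      · simp [Ledger.push, ArithOp.eval, ht, h3', h4', h5, h4]
      · simp [Ledger.push, ArithOp.eval, hq, h3', hscale]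
  · obtain ⟨hr, ha, h3', h4', h5, h6⟩ := hs'
    simp only [Test.Holds, h6, h4', h4] at ht
    refine (Runs.block (l := []) ⟨hr, by simpa [ha] using hrow, fun q => ?_,
      by simpa [ha] using hsent⟩).mono (fun _ h => h) (by simp)
    rcases eq_or_ne q p with rfl | hq
    · simp [Ledger.push, ht, ha, hscale]
    · simp [Ledger.push, hq, ha, hscale]

theorem runs_update {d m : ℕ} {c : ℝ} {M : Ledger} {x : ℕ → ℝ} {s : State}
    (hs : Holds d m c M s) (h0 : s.arr 0 = x) (p : ℕ) (y : ℝ) :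
    Runs linearForecaster.update (s.receiveOutcome p y)
      (fun s' => Holds d m c (M.push d x p (y - p / m)) s') (4 * p + 11 * d + 26) := by
  have hs' : Holds d m c M (s.receiveOutcome p y) := by
    obtain ⟨⟨r0, r2, r4, r8, ra⟩, hrow, hscale, hsent⟩ := hs
    exact ⟨⟨by simpa [State.receiveOutcome], by simpa [State.receiveOutcome],
      by simpa [State.receiveOutcome], by simpa [State.receiveOutcome],
      by simpa [State.receiveOutcome]⟩, hrow, hscale, hsent⟩
  exact ((runs_locateRow hs' h0 (by simp [State.receiveOutcome])
    (by simp [State.receiveOutcome])).seq fun s₁ h₁ =>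
    (runs_updateRow h₁).seq fun s₂ h₂ => runs_updateScale h₂).mono (fun _ h => h) (by omega)

/-! ### The weights -/

/-- The weights sit on `0` and `f 0 ≤ 0`, or on `m` and `0 < f m`, or on two neighbours at which
the weighted values of `f` cancel. -/
theorem weight_cases (m : ℕ) (f : ℕ → ℝ) :
    (f 0 ≤ 0 ∧ weight m f = Pi.single 0 1) ∨ (0 < f m ∧ weight m f = Pi.single m 1) ∨
      ∃ k < m, ∃ a b : ℝ, 0 ≤ a ∧ 0 ≤ b ∧ a + b = 1 ∧ a * f k + b * f (k + 1) = 0 ∧ 0 < f k ∧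
        f (k + 1) ≤ 0 ∧ weight m f = Function.update (Pi.single k a) (k + 1) b := by
  by_cases h0 : crossing m f = 0
  · left
    have := crossing_spec m f
    rw [h0] at this
    exact ⟨this.resolve_left (by omega), by rw [weight, if_pos h0]⟩
  by_cases hm : m < crossing m f
  · exact Or.inr (Or.inl ⟨pos_of_lt_crossing hm, by rw [weight, if_neg h0, if_pos hm]⟩)
  right; right
  obtain ⟨k, hk⟩ := Nat.exists_eq_succ_of_ne_zero h0
  have hpos : 0 < f k := pos_of_lt_crossing (m := m) (by omega)
  have hneg := (crossing_spec m f).resolve_left hm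
  rw [hk, Nat.succ_eq_add_one] at hneg
  have hd : 0 < f k - f (k + 1) := by linarith
  refine ⟨k, by omega, 1 - f k / (f k - f (k + 1)), f k / (f k - f (k + 1)), ?_, by positivity,
    by ring, ?_, hpos, hneg, ?_⟩
  · rw [sub_nonneg, div_le_one hd]; linarith
  · field_simp; ring
  · rw [weight, if_neg h0, if_neg hm, hk]; rfl

theorem sum_single_mul {m k : ℕ} (hk : k ≤ m) (g : ℕ → ℝ) :
    ∑ p : Fin (m + 1), (Pi.single k 1 : ℕ → ℝ) p * g p = g k := by
  rw [← Finset.sum_range fun p => (Pi.single k 1 : ℕ → ℝ) p * g p,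
    Finset.sum_eq_single_of_mem k (by simp; omega)]
  · simp
  · intro b _ hb; simp [hb]

theorem sum_update_mul {m k : ℕ} (hk : k < m) (a b : ℝ) (g : ℕ → ℝ) :
    ∑ p : Fin (m + 1), Function.update (Pi.single k a : ℕ → ℝ) (k + 1) b p * g p =
      a * g k + b * g (k + 1) := by
  rw [← Finset.sum_range fun p => Function.update (Pi.single k a : ℕ → ℝ) (k + 1) b p * g p,
    ← Finset.sum_subset (s₁ := {k, k + 1}), Finset.sum_pair (by omega)]
  · simp
  · intro i hi; simp at hi ⊢; omega
  · intro i _ hi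
    simp only [Finset.mem_insert, Finset.mem_singleton, not_or] at hi
    simp [hi.1, hi.2]

theorem weight_mem_stdSimplex (m : ℕ) (f : ℕ → ℝ) :
    (fun p : Fin (m + 1) => weight m f p) ∈ stdSimplex ℝ (Fin (m + 1)) := by
  rcases weight_cases m f with ⟨_, h⟩ | ⟨_, h⟩ | ⟨k, hk, a, b, ha, hb, hab, _, _, _, h⟩
  · exact ⟨fun p => by simp only [h, Pi.single_apply]; split_ifs <;> norm_num,
      by simpa [h] using sum_single_mul (Nat.zero_le m) fun _ => 1⟩
  · exact ⟨fun p => by simp only [h, Pi.single_apply]; split_ifs <;> norm_num,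
      by simpa [h] using sum_single_mul le_rfl fun _ => 1⟩
  · refine ⟨fun p => ?_, by simpa [h, hab] using sum_update_mul hk a b fun _ => 1⟩
    simp only [h, Function.update_apply, Pi.single_apply]
    split_ifs <;> first | assumption | exact le_rfl

/-- Whatever the label, the expected correlation is at most the mesh times the size of `f`. -/
theorem sum_weight_mul_le {m : ℕ} (hm : 1 ≤ m) {f : ℕ → ℝ} {K y : ℝ} (hK : ∀ p, |f p| ≤ K)
    (h0 : 0 ≤ y) (h1 : y ≤ 1) :
    ∑ p : Fin (m + 1), weight m f p * ((y - (p : ℕ) / (m : ℝ)) * f p) ≤ K / m := by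
  have hm' : (0 : ℝ) < m := by exact_mod_cast hm
  have hK0 : 0 ≤ K / m := div_nonneg ((abs_nonneg _).trans (hK 0)) hm'.le
  rcases weight_cases m f with ⟨hf, h⟩ | ⟨hf, h⟩ | ⟨k, hk, a, b, ha, hb, hab, hz, hf, hf', h⟩
  · rw [h, sum_single_mul (Nat.zero_le m) fun p => (y - (p : ℕ) / (m : ℝ)) * f p]
    refine le_trans ?_ hK0
    simpa using mul_nonpos_of_nonneg_of_nonpos h0 hf
  · rw [h, sum_single_mul le_rfl fun p => (y - (p : ℕ) / (m : ℝ)) * f p, div_self hm'.ne']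
    exact le_trans (mul_nonpos_of_nonpos_of_nonneg (by linarith) hf.le) hK0
  · rw [h, sum_update_mul hk a b fun p => (y - (p : ℕ) / (m : ℝ)) * f p]
    -- Measuring both errors from the left point `k / m` leaves a multiple of the vanishing weighted
    -- sum, and one term of the size of the mesh.
    have e : a * ((y - (k : ℕ) / (m : ℝ)) * f k) +
        b * ((y - ((k + 1 : ℕ) : ℝ) / (m : ℝ)) * f (k + 1)) =
        (y - k / m) * (a * f k + b * f (k + 1)) + b * -f (k + 1) / m := by
      push_cast; ring
    rw [e, hz, mul_zero, zero_add]
    gcongr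
    calc b * -f (k + 1) ≤ 1 * -f (k + 1) :=
          mul_le_mul_of_nonneg_right (by linarith) (by linarith)
      _ ≤ K := by rw [one_mul]; exact (neg_le_abs _).trans (hK _)

/-! ### The potential -/

/-- The squared Euclidean norm of a row. -/
def Ledger.normSq (d : ℕ) (M : Ledger) (p : ℕ) : ℝ := ∑ i ∈ Finset.range d, M.row p i ^ 2

/-- Twice an upper bound for the norm of a row. -/
def Ledger.cost (d : ℕ) (M : Ledger) (p : ℕ) : ℝ := M.normSq d p / M.scale p + M.scale p

/-- Each scale is at least `c` and at least the norm of its row. -/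
structure Ledger.Balanced (d : ℕ) (c : ℝ) (M : Ledger) : Prop where
  le_scale : ∀ p, c ≤ M.scale p
  normSq_le : ∀ p, M.normSq d p ≤ M.scale p ^ 2

theorem Ledger.normSq_nonneg (d : ℕ) (M : Ledger) (p : ℕ) : 0 ≤ M.normSq d p :=
  Finset.sum_nonneg fun _ _ => sq_nonneg _

theorem Ledger.normSq_push_self (d : ℕ) (M : Ledger) (x : ℕ → ℝ) (p : ℕ) (v : ℝ) :
    (M.push d x p v).normSq d p = ∑ i ∈ Finset.range d, (M.row p i + x i * v) ^ 2 := by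
  simp [Ledger.normSq, Ledger.push]

theorem Ledger.scale_push_self (d : ℕ) (M : Ledger) (x : ℕ → ℝ) (p : ℕ) (v : ℝ) :
    (M.push d x p v).scale p = if M.scale p ^ 2 < (M.push d x p v).normSq d p then
      (M.push d x p v).normSq d p / M.scale p else M.scale p := by
  rw [normSq_push_self]
  simp [Ledger.push]

theorem Ledger.normSq_push_of_ne (d : ℕ) (M : Ledger) (x : ℕ → ℝ) {p q : ℕ} (v : ℝ) (h : q ≠ p) :
    (M.push d x p v).normSq d q = M.normSq d q := by
  simp [Ledger.normSq, Ledger.push, h]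

theorem Ledger.scale_push_of_ne (d : ℕ) (M : Ledger) (x : ℕ → ℝ) {p q : ℕ} (v : ℝ) (h : q ≠ p) :
    (M.push d x p v).scale q = M.scale q := by
  simp [Ledger.push, h]

/-- A scale σ changes only if the new squared norm q exceeds σ². Then q/σ > σ, so the scale grows,
and (q/σ)² ≥ σ · (q/σ) = q. -/
theorem Ledger.Balanced.push {d : ℕ} {c : ℝ} (hc : 0 < c) {M : Ledger} (h : M.Balanced d c)
    (x : ℕ → ℝ) (p : ℕ) (v : ℝ) : (M.push d x p v).Balanced d c := by
  have hs := hc.trans_le (h.le_scale p)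
  have key : c ≤ (M.push d x p v).scale p ∧
      (M.push d x p v).normSq d p ≤ (M.push d x p v).scale p ^ 2 := by
    rw [scale_push_self]
    generalize (M.push d x p v).normSq d p = q
    split_ifs with hq
    · have : M.scale p ≤ q / M.scale p := by rw [le_div_iff₀ hs, ← sq]; exact hq.le
      refine ⟨(h.le_scale p).trans this, ?_⟩
      calc q = q / M.scale p * M.scale p := by field_simp
        _ ≤ q / M.scale p * (q / M.scale p) := by gcongr; exact hs.le.trans this
        _ = _ := by ring
    · exact ⟨h.le_scale p, not_lt.1 hq⟩
  constructor <;> intro q <;> rcases eq_or_ne q p with rfl | hq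
  · exact key.1
  · rw [scale_push_of_ne _ _ _ _ hq]; exact h.le_scale q
  · exact key.2
  · rw [scale_push_of_ne _ _ _ _ hq, normSq_push_of_ne _ _ _ _ hq]; exact h.normSq_le q

/-- The rescaling σ ↦ q/σ leaves q/σ + σ unchanged, so the increment is that of a fixed scale: the
expansion of the square, divided by the old σ. -/
theorem Ledger.cost_push_self (d : ℕ) {M : Ledger} {p : ℕ} (hs : 0 < M.scale p) (x : ℕ → ℝ)
    (v : ℝ) : (M.push d x p v).cost d p =
      M.cost d p + 2 * (v * M.corr d x p) + v ^ 2 * (∑ i ∈ Finset.range d, x i ^ 2) / M.scale p := by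
  have e1 : (M.push d x p v).cost d p = (M.push d x p v).normSq d p / M.scale p + M.scale p := by
    rw [cost, scale_push_self]
    split_ifs with hq
    · have : (M.push d x p v).normSq d p ≠ 0 := ((by positivity : 0 < M.scale p ^ 2).trans hq).ne'
      field_simp
      ring
    · rfl
  have e2 : (M.push d x p v).normSq d p = M.normSq d p +
      2 * v * (∑ i ∈ Finset.range d, x i * M.row p i) + v ^ 2 * ∑ i ∈ Finset.range d, x i ^ 2 := by
    rw [normSq_push_self, normSq, Finset.mul_sum, Finset.mul_sum, ← Finset.sum_add_distrib,
      ← Finset.sum_add_distrib]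
    exact Finset.sum_congr rfl fun _ _ => by ring
  rw [e1, e2, cost, corr]
  ring

/-- Cauchy–Schwarz, with the scale dominating the norm of the row. -/
theorem Ledger.Balanced.abs_corr_le {d : ℕ} {c : ℝ} (hc : 0 < c) {M : Ledger}
    (h : M.Balanced d c) {x : ℕ → ℝ} {r : ℝ} (hr : 0 ≤ r)
    (hx : ∑ i ∈ Finset.range d, x i ^ 2 ≤ r ^ 2) (p : ℕ) : |M.corr d x p| ≤ r := by
  have hs := hc.trans_le (h.le_scale p)
  rw [corr, abs_div, abs_of_pos hs, div_le_iff₀ hs]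
  refine abs_le_of_sq_le_sq ?_ (by positivity)
  calc _ ≤ (∑ i ∈ Finset.range d, x i ^ 2) * M.normSq d p := Finset.sum_mul_sq_le_sq_mul_sq _ _ _
    _ ≤ r ^ 2 * M.scale p ^ 2 :=
        mul_le_mul hx (h.normSq_le p) (M.normSq_nonneg d p) (by positivity)
    _ = _ := by ring

/-- The total cost of the rows `0, …, m`. -/
def Ledger.potential (d m : ℕ) (M : Ledger) : ℝ := ∑ p : Fin (m + 1), M.cost d p

theorem Ledger.potential_push {d m : ℕ} (M : Ledger) (x : ℕ → ℝ) (p : Fin (m + 1)) (v : ℝ) :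
    (M.push d x p v).potential d m =
      M.potential d m + ((M.push d x p v).cost d p - M.cost d p) := by
  rw [potential, potential, ← sub_eq_iff_eq_add', ← Finset.sum_sub_distrib]
  refine Finset.sum_eq_single_of_mem p (Finset.mem_univ p) fun q _ hq => ?_
  have : (q : ℕ) ≠ p := fun h => hq (Fin.ext h)
  rw [cost, cost, scale_push_of_ne _ _ _ _ this, normSq_push_of_ne _ _ _ _ this, sub_self]

/-- The drift of one round: the linear term of `Ledger.cost_push_self` is bounded in expectation by
`sum_weight_mul_le`, the quadratic one pointwise, because |y - p/m| ≤ 1 and every scale is at least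
`c`. -/
theorem Ledger.Balanced.expected_potential_le {d m : ℕ} (hm : 1 ≤ m) {c : ℝ} (hc : 0 < c)
    {M : Ledger} (h : M.Balanced d c) {x : ℕ → ℝ} {r : ℝ} (hr : 0 ≤ r)
    (hx : ∑ i ∈ Finset.range d, x i ^ 2 ≤ r ^ 2) {y : ℝ} (h0 : 0 ≤ y) (h1 : y ≤ 1) :
    ∑ p : Fin (m + 1), weight m (M.corr d x) p *
        (M.push d x p (y - (p : ℕ) / (m : ℝ))).potential d m ≤
      M.potential d m + (2 * r / m + r ^ 2 / c) := by
  have hm' : (0 : ℝ) < m := by exact_mod_cast hm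
  obtain ⟨hw, hw1⟩ := weight_mem_stdSimplex m (M.corr d x)
  calc _ ≤ ∑ p : Fin (m + 1), (weight m (M.corr d x) p * (M.potential d m + r ^ 2 / c) +
        2 * (weight m (M.corr d x) p * ((y - (p : ℕ) / (m : ℝ)) * M.corr d x p))) := by
        refine Finset.sum_le_sum fun p _ => ?_
        have hs := hc.trans_le (h.le_scale p)
        have hp : ((p : ℕ) : ℝ) / m ≤ 1 := by
          rw [div_le_one hm']
          exact_mod_cast Nat.lt_succ_iff.1 p.2
        have hp0 : 0 ≤ ((p : ℕ) : ℝ) / m := by positivity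
        have hv : (y - (p : ℕ) / (m : ℝ)) ^ 2 ≤ 1 := by
          rw [sq_le_one_iff_abs_le_one, abs_le]; constructor <;> linarith
        have hq : (y - (p : ℕ) / (m : ℝ)) ^ 2 * (∑ i ∈ Finset.range d, x i ^ 2) / M.scale p ≤
            r ^ 2 / c := by
          refine div_le_div₀ (by positivity) ?_ hc (h.le_scale p)
          calc _ ≤ 1 * r ^ 2 := mul_le_mul hv hx (Finset.sum_nonneg fun _ _ => sq_nonneg _) zero_le_one
            _ = _ := one_mul _
        rw [potential_push, cost_push_self d hs]
        have := mul_le_mul_of_nonneg_left hq (hw p)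
        linarith
    _ = (M.potential d m + r ^ 2 / c) + 2 * ∑ p : Fin (m + 1),
        weight m (M.corr d x) p * ((y - (p : ℕ) / (m : ℝ)) * M.corr d x p) := by
        rw [Finset.sum_add_distrib, ← Finset.sum_mul, hw1, one_mul, Finset.mul_sum]
    _ ≤ _ := by
        have := sum_weight_mul_le hm (h.abs_corr_le hc hr hx) h0 h1
        rw [mul_div_assoc]
        linarith

/-! ### The learner -/

/-- The learner that puts the weights around the sign change of the normalized correlations. -/
def forecaster (d m : ℕ) (c : ℝ) : Learner d m := fun π x =>
  ⟨fun p => weight m ((ledger c π).corr d (pad x)) p, weight_mem_stdSimplex _ _⟩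

theorem ledger_balanced {c : ℝ} (hc : 0 < c) {d m : ℕ} (π : History d m) :
    (ledger c π).Balanced d c := by
  induction π using List.reverseRecOn with
  | nil => exact ⟨fun p => le_rfl, fun p => by simp [ledger, Ledger.normSq]; positivity⟩
  | append_singleton π r ih => rw [ledger_append]; exact ih.push hc _ _ _

theorem sum_pad_sq_le {d : ℕ} (x : Context d) {r : ℝ} (hr : (d : ℝ) ≤ r ^ 2) :
    ∑ i ∈ Finset.range d, pad x i ^ 2 ≤ r ^ 2 := by
  refine le_trans ?_ hr
  calc _ ≤ ∑ i ∈ Finset.range d, (1 : ℝ) := Finset.sum_le_sum fun i hi => by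
        have hi := Finset.mem_range.1 hi
        simp only [pad, hi, dif_pos]
        exact pow_le_one₀ (x ⟨i, hi⟩).2.1 (x ⟨i, hi⟩).2.2
    _ = d := by simp

/-- Induction on the number of remaining rounds: the drift bound holds after every history, so an
adaptive adversary gains nothing. -/
theorem expect_forecaster_le {d m T : ℕ} (hm : 1 ≤ m) {c : ℝ} (hc : 0 < c) {r : ℝ} (hr : 0 ≤ r)
    (hd : (d : ℝ) ≤ r ^ 2) (adv : Adversary d m) {F : History d m → ℝ} {a : ℝ} (ha : 0 ≤ a)
    (hF : ∀ π, π.length = T → F π ≤ a * (ledger c π).potential d m) (n : ℕ) (π : History d m)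
    (hπ : π.length + n = T) :
    expect (forecaster d m c) adv F n π ≤
      a * ((ledger c π).potential d m + n * (2 * r / m + r ^ 2 / c)) := by
  induction n generalizing π with
  | zero => simpa [expect] using hF π hπ
  | succ n ih =>
    have hB := ledger_balanced hc π
    obtain ⟨hw, hw1⟩ := weight_mem_stdSimplex m ((ledger c π).corr d (pad (adv π).1))
    have key := hB.expected_potential_le hm hc hr (sum_pad_sq_le (adv π).1 hd)
      (adv π).2.2.1 (adv π).2.2.2
    rw [expect]
    calc _ ≤ ∑ p : Fin (m + 1), weight m ((ledger c π).corr d (pad (adv π).1)) p *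
          (a * (((ledger c π).push d (pad (adv π).1) p
            (((adv π).2 : ℝ) - (p : ℕ) / (m : ℝ))).potential d m +
              n * (2 * r / m + r ^ 2 / c))) := by
          refine Finset.sum_le_sum fun p _ => mul_le_mul_of_nonneg_left ?_ (hw p)
          have := ih (π ++ [⟨(adv π).1, p, (adv π).2⟩]) (by simp; omega)
          rwa [ledger_append] at this
      _ = a * (∑ p : Fin (m + 1), weight m ((ledger c π).corr d (pad (adv π).1)) p *
          ((ledger c π).push d (pad (adv π).1) p
            (((adv π).2 : ℝ) - (p : ℕ) / (m : ℝ))).potential d m +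
          (∑ p : Fin (m + 1), weight m ((ledger c π).corr d (pad (adv π).1)) p) *
            (n * (2 * r / m + r ^ 2 / c))) := by
          rw [Finset.sum_mul, ← Finset.sum_add_distrib, Finset.mul_sum]
          exact Finset.sum_congr rfl fun p _ => by ring
      _ ≤ _ := by
          rw [hw1]
          refine mul_le_mul_of_nonneg_left ?_ ha
          push_cast
          linarith

/-! ### From the potential to the multicalibration error. -/

theorem sum_filter_eq {c : ℝ} {d m : ℕ} (π : History d m) (h : Fin d → ℝ) (p : Fin (m + 1)) :
    ((π.filter (fun r => r.pred = p)).map (fun r => (∑ i, h i * (r.context i : ℝ)) *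
      ((r.label : ℝ) - (p : ℝ) / (m : ℝ)))).sum = ∑ i : Fin d, h i * (ledger c π).row p i := by
  induction π using List.reverseRecOn with
  | nil => simp [ledger]
  | append_singleton π r ih =>
    rw [List.filter_append, List.map_append, List.sum_append, ih, ledger_append]
    by_cases hp : r.pred = p
    · simp only [hp, Ledger.push, Function.update_self, mul_add, Finset.sum_add_distrib]
      congr 1
      simp [hp, pad, Finset.sum_mul, mul_assoc]
    · have : (p : ℕ) ≠ r.pred := fun h => hp (Fin.ext h.symm)
      simp [hp, Ledger.push, this]

/-- Duality of ℓ₁ and ℓ∞ reduces the supremum over `h` to the largest coordinate of each row, which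
is at most the Euclidean norm and hence at most half the cost. -/
theorem multiCalError_le {c : ℝ} (hc : 0 < c) {d m : ℕ} {B : ℝ} (hB : 0 ≤ B) (π : History d m) :
    multiCalError π (linearClass d B) ≤
      B / (2 * π.length) * (ledger c π).potential d m := by
  have hbal := ledger_balanced hc π
  have hcost : ∀ p, 0 ≤ (ledger c π).cost d p := fun p =>
    have hs := hc.trans_le (hbal.le_scale p)
    add_nonneg (div_nonneg (Ledger.normSq_nonneg _ _ _) hs.le) hs.le
  refine Real.sSup_le ?_ (mul_nonneg (by positivity) (Finset.sum_nonneg fun p _ => hcost p))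
  rintro _ ⟨_, ⟨h, hh, rfl⟩, rfl⟩
  rw [calError, Ledger.potential, Finset.mul_sum]
  refine Finset.sum_le_sum fun p _ => ?_
  have hs := hc.trans_le (hbal.le_scale p)
  rw [sum_filter_eq (c := c)]
  have hrow : ∀ i : Fin d, |(ledger c π).row p i| ≤ (ledger c π).cost d p / 2 := by
    intro i
    have h1 : (ledger c π).row p i ^ 2 ≤ (ledger c π).normSq d p :=
      Finset.single_le_sum (f := fun i => (ledger c π).row p i ^ 2) (fun _ _ => sq_nonneg _)
        (Finset.mem_range.2 i.2)
    have h2 : |(ledger c π).row p i| ^ 2 / (ledger c π).scale p ≤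
        (ledger c π).normSq d p / (ledger c π).scale p := by
      rw [sq_abs]; gcongr
    -- The inequality of arithmetic and geometric means; the difference of the two sides is a square
    -- over the scale.
    have h3 : 2 * |(ledger c π).row p i| ≤
        |(ledger c π).row p i| ^ 2 / (ledger c π).scale p + (ledger c π).scale p := by
      rw [← sub_nonneg]
      have : |(ledger c π).row p i| ^ 2 / (ledger c π).scale p + (ledger c π).scale p -
          2 * |(ledger c π).row p i| =
          (|(ledger c π).row p i| - (ledger c π).scale p) ^ 2 / (ledger c π).scale p := by
        field_simp; ring
      rw [this]; positivity
    rw [Ledger.cost]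
    linarith
  have hsum : |∑ i : Fin d, h i * (ledger c π).row p i| ≤ B * ((ledger c π).cost d p / 2) :=
    calc _ ≤ ∑ i : Fin d, |h i| * ((ledger c π).cost d p / 2) :=
          (Finset.abs_sum_le_sum_abs _ _).trans (Finset.sum_le_sum fun i _ => by
            rw [abs_mul]; exact mul_le_mul_of_nonneg_left (hrow i) (abs_nonneg _))
      _ ≤ _ := by
          rw [← Finset.sum_mul]
          exact mul_le_mul_of_nonneg_right hh (by linarith [hcost p])
  calc _ ≤ 1 / (π.length : ℝ) * (B * ((ledger c π).cost d p / 2)) := by gcongr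
    _ = _ := by rw [mul_comm 2 (π.length : ℝ), ← div_div]; ring

/-! ### The running time -/

theorem forecaster_implements {d T m s : ℕ} (B : ℝ) (hd : 1 ≤ d) (hm : 1 ≤ m) (hT : T ≤ m ^ 3)
    (hmin : ∀ k, 1 ≤ k → k < m → k ^ 3 < T) (hs : 1 ≤ s) (hs' : d ≤ s ^ 2)
    (hmin' : ∀ k, 1 ≤ k → k < s → k ^ 2 < d) :
    linearForecaster.Implements d T B (forecaster d m (m * s)) (48 * (m + 1) * (d + 1)) := by
  obtain ⟨s₀, n₀, he₀, hn₀, hs₀⟩ := runs_setup B hm hT hmin hs hs' hmin'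
  -- Needed to absorb the `6 * s` steps of the set-up. Otherwise minimality of `s` would give `d² <
  -- d`.
  have hsd : s ≤ d := by
    by_contra! h
    have := hmin' d hd h
    have := Nat.le_self_pow (two_ne_zero) d
    omega
  have hpre : ∀ (π : History d m) (st : {st // Holds d m (m * s) (ledger (m * s) π) st})
      (x : Context d), ∃ (s' : State) (n : ℕ),
      Exec linearForecaster.predict (st.1.receiveContext x) s' n ∧
      n ≤ (m + 1) * (8 * d + 13) + 5 * m + 24 ∧
      Holds d m (m * s) (ledger (m * s) π) s' ∧ s'.arr 0 = pad x ∧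
      ∀ q < m + 1, s'.arr 1 q = weight m ((ledger (m * s) π).corr d (pad x)) q :=
    fun π st x => runs_predict x st.2
  choose pre npre hpre hnpre hHolds harr hweight using hpre
  have hupd : ∀ (π : History d m) (st : {st // Holds d m (m * s) (ledger (m * s) π) st})
      (r : Round d m), ∃ (s' : State) (n : ℕ),
      Exec linearForecaster.update ((pre π st r.context).receiveOutcome r.pred r.label) s' n ∧
      n ≤ 4 * r.pred + 11 * d + 26 ∧ Holds d m (m * s) (ledger (m * s) (π ++ [r])) s' :=
    fun π st r => by
      rw [ledger_append]
      exact runs_update (hHolds π st r.context) (harr π st r.context) r.pred r.label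
  choose upd nupd hupd hnupd hHolds' using hupd
  -- The memory is defined by recursion on the last round. The subtype carries `Holds` along, so
  -- that `predict` and `update` are known to halt from every state reached.
  let σ (π : History d m) : {st // Holds d m (m * s) (ledger (m * s) π) st} :=
    List.reverseRecOn π ⟨s₀, hs₀⟩ fun π r ih => ⟨upd π ih r, hHolds' π ih r⟩
  have hσ (π : History d m) (r : Round d m) : (σ (π ++ [r])).1 = upd π (σ π) r := by
    simp only [σ, List.reverseRecOn_concat]
  have hσ₀ : (σ []).1 = s₀ := by simp only [σ, List.reverseRecOn_nil]
  refine ⟨fun π => (σ π).1, ⟨n₀, by simpa only [hσ₀] using he₀, by nlinarith, (σ []).2.regs.disc⟩,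
    fun π _ x => ⟨pre π (σ π) x, npre π (σ π) x, hpre π (σ π) x,
      fun p => hweight π (σ π) x p p.2, fun p y => ⟨nupd π (σ π) ⟨x, p, y⟩, ?_, ?_⟩⟩⟩
  · simp only [hσ]
    exact hupd π (σ π) ⟨x, p, y⟩
  · have h₁ := hnpre π (σ π) x
    have h₂ := hnupd π (σ π) ⟨x, p, y⟩
    have h₃ : (p : ℕ) ≤ m := Nat.lt_succ_iff.1 p.2
    simp only at h₂
    nlinarith

/-- The integer root, rounded up, together with its defining properties. -/
theorem exists_ceil_root (j N : ℕ) (hj : j ≠ 0) (hN : 1 ≤ N) :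
    ∃ k, 1 ≤ k ∧ N ≤ k ^ j ∧ (∀ l, 1 ≤ l → l < k → l ^ j < N) ∧ k ^ j ≤ 2 ^ j * N := by
  classical
  have hex : ∃ k, 1 ≤ k ∧ N ≤ k ^ j := ⟨N, hN, Nat.le_self_pow hj N⟩
  obtain ⟨h1, h2⟩ := Nat.find_spec hex
  have hmin : ∀ l, 1 ≤ l → l < Nat.find hex → l ^ j < N := fun l hl hlt => by
    by_contra! h
    exact Nat.find_min hex hlt ⟨hl, h⟩
  refine ⟨_, h1, h2, hmin, ?_⟩
  -- If the root `k` is at least 2, then `k ≤ 2 (k - 1)`, and `k - 1` still has `j`-th power below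
  -- `N`.
  rcases h1.eq_or_lt with h | h
  · rw [← h, one_pow]
    exact Nat.mul_pos (by positivity) hN
  · calc Nat.find hex ^ j ≤ (2 * (Nat.find hex - 1)) ^ j := Nat.pow_le_pow_left (by omega) j
      _ = 2 ^ j * (Nat.find hex - 1) ^ j := mul_pow _ _ _
      _ ≤ _ := Nat.mul_le_mul_left _ (hmin _ (by omega) (by omega)).le

/-- Used with `e = d - 1` and `e = d - 3` to absorb the factor `d + 1`. As only `X ≥ √2` is
available, the estimate is proved for the squares; it is sharp at `e = 0`. -/
theorem add_four_le_mul_pow {X : ℝ} (hX : 0 ≤ X) (h : 2 ≤ X ^ 2) (e : ℕ) :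
    (e : ℝ) + 4 ≤ 4 * X ^ e := by
  have h1 : (e + 4) ^ 2 ≤ 16 * 2 ^ e := by
    induction e with
    | zero => norm_num
    | succ e ih =>
      have : (e + 1 + 4) ^ 2 ≤ 2 * (e + 4) ^ 2 := by
        ring_nf
        nlinarith [Nat.zero_le (e ^ 2)]
      rw [pow_succ 2]
      linarith
  refine le_of_sq_le_sq ?_ (by positivity)
  calc ((e : ℝ) + 4) ^ 2 ≤ 16 * 2 ^ e := by exact_mod_cast h1
    _ ≤ 16 * (X ^ 2) ^ e := by gcongr
    _ = (4 * X ^ e) ^ 2 := by ring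

/-- With X = max(1, B) √T, one factor X pays for `m` and the other `d - 1` pay for `d + 1`. In the
total, the `T + 1` phases use two further factors, whence `3 ≤ d`. -/
theorem time_bounds {d T m : ℕ} {B : ℝ} (hd : 1 ≤ d) (hT : 1 ≤ T) (hBT : 2 ≤ B * (T : ℝ))
    (hm : 1 ≤ m) (hm3 : m ^ 3 ≤ 2 ^ 3 * T) :
    ((48 * (m + 1) * (d + 1) : ℕ) : ℝ) ≤ 2000 * (max 1 B * √(T : ℝ)) ^ d ∧
      (3 ≤ d → ((T : ℝ) + 1) * ((48 * (m + 1) * (d + 1) : ℕ) : ℝ) ≤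
        2000 * (max 1 B * √(T : ℝ)) ^ d) := by
  have hT' : (1 : ℝ) ≤ T := by exact_mod_cast hT
  have hm' : (1 : ℝ) ≤ m := by exact_mod_cast hm
  have hq : √(T : ℝ) ^ 2 = T := Real.sq_sqrt (by positivity)
  have hq1 : 1 ≤ √(T : ℝ) := Real.one_le_sqrt.2 hT'
  have hXq : √(T : ℝ) ≤ max 1 B * √(T : ℝ) := le_mul_of_one_le_left (by positivity) (le_max_left _ _)
  have hX2 : 2 ≤ (max 1 B * √(T : ℝ)) ^ 2 := by
    rw [mul_pow, hq]
    -- For `T = 1` the hypothesis `2 ≤ B * T` gives `B ≥ 2`; for `T ≥ 2` the factor √T alone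
    -- suffices.
    rcases hT.eq_or_lt with h | h
    · rw [← h] at hBT ⊢
      have : 2 ≤ max 1 B := le_max_of_le_right (by simpa using hBT)
      push_cast
      nlinarith
    · have h2 : (2 : ℝ) ≤ T := by exact_mod_cast h
      have : (1 : ℝ) ≤ max 1 B ^ 2 := one_le_pow₀ (le_max_left _ _)
      nlinarith
  have hmq : (m : ℝ) ≤ 2 * √(T : ℝ) := by
    refine le_of_pow_le_pow_left₀ (n := 3) (by norm_num) (by positivity) ?_
    calc (m : ℝ) ^ 3 ≤ 2 ^ 3 * T := by exact_mod_cast hm3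
      _ = 2 ^ 3 * √(T : ℝ) ^ 2 * 1 := by rw [hq, mul_one]
      _ ≤ 2 ^ 3 * √(T : ℝ) ^ 2 * √(T : ℝ) := by gcongr
      _ = _ := by ring
  generalize max 1 B * √(T : ℝ) = X at hXq hX2 ⊢
  have hX : 0 ≤ X := by linarith
  have hτ : ((48 * (m + 1) * (d + 1) : ℕ) : ℝ) ≤ 96 * m * (d + 1) := by
    push_cast
    refine mul_le_mul_of_nonneg_right ?_ (by positivity)
    linarith
  constructor
  · obtain ⟨e, rfl⟩ := Nat.exists_eq_add_of_le' hd
    have := add_four_le_mul_pow hX hX2 e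
    calc _ ≤ 96 * (2 * X) * (4 * X ^ e) := by
          refine hτ.trans ?_
          push_cast
          gcongr <;> linarith
      _ = 768 * X ^ (e + 1) := by ring
      _ ≤ _ := by gcongr; norm_num
  · intro h3
    obtain ⟨e, rfl⟩ := Nat.exists_eq_add_of_le' h3
    have := add_four_le_mul_pow hX hX2 e
    calc _ ≤ 2 * X ^ 2 * (96 * (2 * X) * (4 * X ^ e)) := by
          refine mul_le_mul ?_ (hτ.trans ?_) (by positivity) (by positivity)
          · have : √(T : ℝ) ^ 2 ≤ X ^ 2 := by gcongr
            linarith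
          · push_cast
            gcongr <;> linarith
      _ = 1536 * X ^ (e + 3) := by ring
      _ ≤ _ := by gcongr; norm_num

/-! ### The error -/

theorem error_bound {d T m s : ℕ} {B : ℝ} (hd : 1 ≤ d) (hT : 1 ≤ T) (hB : 0 < B)
    (hBT : 2 ≤ B * (T : ℝ)) (hm : 1 ≤ m) (hmT : T ≤ m ^ 3) (hm3 : m ^ 3 ≤ 2 ^ 3 * T)
    (hs : 1 ≤ s) (hds : d ≤ s ^ 2) (hs2 : s ^ 2 ≤ 2 ^ 2 * d) (adv : Adversary d m) :
    expect (forecaster d m (m * s)) adv (fun π => multiCalError π (linearClass d B)) T [] ≤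
      2000 * (B * √(d : ℝ) * (T : ℝ) ^ (-(1 / 3) : ℝ) * Real.log (B * (T : ℝ))) := by
  have hT' : (0 : ℝ) < T := by exact_mod_cast hT
  have hm' : (1 : ℝ) ≤ m := by exact_mod_cast hm
  have hs' : (1 : ℝ) ≤ s := by exact_mod_cast hs
  have hc : (0 : ℝ) < m * s := by positivity
  have key := expect_forecaster_le (T := T) hm hc (r := s) (by positivity)
    (by exact_mod_cast hds) adv (F := fun π => multiCalError π (linearClass d B))
    (a := B / (2 * T)) (by positivity)
    (fun π hπ => hπ ▸ multiCalError_le hc hB.le π) T [] (by simp)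
  refine key.trans ?_
  have hpot : (ledger (m * s : ℝ) ([] : History d m)).potential d m = (m + 1) * (m * s) := by
    simp [ledger, Ledger.potential, Ledger.cost, Ledger.normSq]
  have hmR : (m : ℝ) ≤ 2 * (T : ℝ) ^ (1 / 3 : ℝ) := by
    refine le_of_pow_le_pow_left₀ (n := 3) (by norm_num) (by positivity) ?_
    rw [mul_pow, ← Real.rpow_natCast ((T : ℝ) ^ (1 / 3 : ℝ)), ← Real.rpow_mul hT'.le]
    norm_num
    exact_mod_cast hm3
  have hsR : (s : ℝ) ≤ 2 * √(d : ℝ) := by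
    refine le_of_sq_le_sq ?_ (by positivity)
    rw [mul_pow, Real.sq_sqrt (by positivity)]
    exact_mod_cast hs2
  have hTm : (T : ℝ) / m ≤ m ^ 2 := by
    rw [div_le_iff₀ (by positivity)]
    exact_mod_cast hmT.trans_eq (pow_succ m 2)
  -- The initial potential contributes at most 2m²s. The drift is 3s/m per round, at most 3m²s over
  -- all rounds because T ≤ m³.
  have htot : ((m : ℝ) + 1) * (m * s) + T * (2 * s / m + s ^ 2 / (m * s)) ≤ 5 * m ^ 2 * s := by
    have e : (T : ℝ) * (2 * s / m + s ^ 2 / (m * s)) = 3 * s * (T / m) := by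
      field_simp; ring
    have := mul_le_mul_of_nonneg_left hTm (by positivity : 0 ≤ 3 * (s : ℝ))
    have h2 : ((m : ℝ) + 1) * (m * s) ≤ 2 * m * (m * s) := by gcongr; linarith
    rw [e]
    linarith
  have hrpow : ((T : ℝ) ^ (1 / 3 : ℝ)) ^ 2 / T = (T : ℝ) ^ (-(1 / 3) : ℝ) := by
    rw [← Real.rpow_natCast ((T : ℝ) ^ (1 / 3 : ℝ)), ← Real.rpow_mul hT'.le, ← Real.rpow_sub_one hT'.ne']
    norm_num
  -- The estimate with constant 20 has no logarithm; the lower bound 1/2 allows the factor to be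
  -- inserted.
  have hlog : 1 / 2 ≤ Real.log (B * T) := by
    have := Real.log_le_log (by norm_num) hBT
    have := Real.log_two_gt_d9
    linarith
  have hR : 0 ≤ B * √(d : ℝ) * (T : ℝ) ^ (-(1 / 3) : ℝ) := by positivity
  rw [hpot]
  calc B / (2 * T) * (((m : ℝ) + 1) * (m * s) + T * (2 * s / m + s ^ 2 / (m * s)))
      ≤ B / (2 * T) * (5 * (2 * (T : ℝ) ^ (1 / 3 : ℝ)) ^ 2 * (2 * √(d : ℝ))) := by
        refine mul_le_mul_of_nonneg_left (htot.trans ?_) (by positivity)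
        gcongr
    _ = 20 * (B * √(d : ℝ) * (((T : ℝ) ^ (1 / 3 : ℝ)) ^ 2 / T)) := by field_simp; ring
    _ = 20 * (B * √(d : ℝ) * (T : ℝ) ^ (-(1 / 3) : ℝ)) := by rw [hrpow]
    _ ≤ _ := by nlinarith

end OnlineMC

end

theorem corollary1 :
    ∃ (A : OnlineMC.Algorithm) (C : ℝ), 0 < C ∧
      ∀ (d T : ℕ) (B : ℝ), 1 ≤ d → 1 ≤ T → 0 < B → 2 ≤ B * (T : ℝ) →
        ∃ (m : ℕ) (L : OnlineMC.Learner d m) (τ : ℕ), 1 ≤ m ∧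
          A.Implements d T B L τ ∧
          (τ : ℝ) ≤ C * (max 1 B * √(T : ℝ)) ^ d ∧
          (3 ≤ d → ((T : ℝ) + 1) * (τ : ℝ) ≤ C * (max 1 B * √(T : ℝ)) ^ d) ∧
          ∀ adv : OnlineMC.Adversary d m,
            OnlineMC.expect L adv
                (fun π => OnlineMC.multiCalError π (OnlineMC.linearClass d B)) T [] ≤
              C * (B * √(d : ℝ) * (T : ℝ) ^ (-(1 / 3) : ℝ) * Real.log (B * (T : ℝ))) := by
  refine ⟨OnlineMC.linearForecaster, 2000, by norm_num, fun d T B hd hT hB hBT => ?_⟩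
  obtain ⟨m, hm, hmT, hmin, hm3⟩ := OnlineMC.exists_ceil_root 3 T (by norm_num) hT
  obtain ⟨s, hs, hds, hmin', hs2⟩ := OnlineMC.exists_ceil_root 2 d (by norm_num) hd
  obtain ⟨h1, h2⟩ := OnlineMC.time_bounds hd hT hBT hm hm3
  exact ⟨m, OnlineMC.forecaster d m (m * s), _, hm,
    OnlineMC.forecaster_implements B hd hm hmT hmin hs hds hmin', h1, h2,
    OnlineMC.error_bound hd hT hB hBT hm hmT hm3 hs hds hs2⟩
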